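/- **Theorem 2.8 (Noncommutative Lévy–Skorohod inequality).** Let $\mathfrak{M}$ be a von Neumann algebra on a complex Hilbert space with a normal faithful tracial state $\tau$. For a self-adjoint $x\in\mathfrak{M}$ with spectral measure $E$ and a Borel set $B\subseteq\mathbb{R}$ write $e_B(x)=E(B)$, and for $c\in\mathbb{R}$ write $e_c(x)=e_{(-\infty,c)}(x)$ and $e_c^{\perp}(x)=\mathbf{1}-e_c(x)$. Let $n\ge 1$ and let $x_1,\dots,x_n\in\mathfrak{M}$ be self-adjoint and weakly fully independent, i.e. for every $1<j\le n$, $$\tau(ab)=\tau(a)\tau(b)\qquad\text{for all } a\in W^*(x_1,\dots,x_{j-1}),\ b\in W^*(x_j,\dots,x_n),$$ where $W^*(S)$ denotes the von Neumann algebra generated by $S$. Let $s_k=x_1+\cdots+x_k$ and suppose that $s_ks_n=s_ns_k$ for $k=1,\dots,n$. Let $\lambda>0$ and $0<\alpha<1$, and put $$m_\lambda=\min_{1\le k\le n}\tau\left(e^{\perp}_{-(1-\alpha)\lambda}(s_n-s_k)\right),\qquad M_\lambda=\frac1{m_\lambda}\quad(\text{with } 1/0=\infty).$$ Then there exists a projection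 $p\in\mathfrak{M}$ such that $$\max_{1\le k\le n}\frac1{2^{k-1}}\,\tau\left(e_{(\lambda,\infty)}(s_k)\right)\ \le\ \tau(p)\ \le\ M_\lambda\,\tau\left(e_{(\alpha\lambda,\infty)}(s_n)\right),$$ where the upper bound is read as $+\infty$ (no condition) when $m_\lambda=0$, even if $\tau(e_{(\alpha\lambda,\infty)}(s_n))=0$. -/

import Mathlib

/-! Tracial von Neumann algebras, spectral projections and weakly full independence. -/

noncomputable section

namespace QuantumProbability

universe u

variable {H : Type u} [NormedAddCommGroup H] [InnerProductSpace ℂ H] [CompleteSpace H]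

/-- The algebra of (bounded) random variables: the elements of the von Neumann algebra `M`. -/
abbrev RV (M : VonNeumannAlgebra H) : Type u := M.toStarSubalgebra

/-- A normal faithful tracial state on a von Neumann algebra `M` acting on `H`. The order is the
usual (Loewner) order of operators. -/
structure NormalFaithfulTracialState (M : VonNeumannAlgebra H) where
  /-- the underlying linear functional -/
  toLinearMap : RV M →ₗ[ℂ] ℂ
  /-- positivity -/
  nonneg : ∀ a : RV M, 0 ≤ (a : H →L[ℂ] H) →
    0 ≤ (toLinearMap a).re ∧ (toLinearMap a).im = 0
  /-- normalization -/
  map_one : toLinearMap 1 = 1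
  /-- trace property -/
  tracial : ∀ a b : RV M, toLinearMap (a * b) = toLinearMap (b * a)
  /-- faithfulness -/
  faithful : ∀ a : RV M, 0 ≤ (a : H →L[ℂ] H) → toLinearMap a = 0 → a = 0
  /-- normality: the state preserves suprema of bounded increasing nets of positive elements -/
  normal : ∀ (D : Set (RV M)) (a : RV M), D.Nonempty →
    (∀ d ∈ D, 0 ≤ (d : H →L[ℂ] H)) →
    DirectedOn (fun c d : RV M => (c : H →L[ℂ] H) ≤ (d : H →L[ℂ] H)) D →
    IsLUB ((fun d : RV M => (d : H →L[ℂ] H)) '' D) (a : H →L[ℂ] H) →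
    IsLUB ((fun d : RV M => (toLinearMap d).re) '' D) (toLinearMap a).re

instance (M : VonNeumannAlgebra H) :
    CoeFun (NormalFaithfulTracialState M) (fun _ => RV M → ℂ) :=
  ⟨fun τ => τ.toLinearMap⟩

/-- For a self-adjoint operator `x` and an open set `U` of real numbers: the range of the spectral
projection `E(U) = 1_U(x)`, that is, the closed linear span of the ranges of all the operators
`f(x)` (continuous functional calculus), where `f` runs over the continuous real functions that
vanish outside `U`. (The indicator of `U` is the increasing pointwise limit of such functions,
and `f(x) = 1_U(x) f(x)` for each of them.) -/
def openSpectralSubspace (x : H →L[ℂ] H) (U : Set ℝ) : Submodule ℂ H :=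
  (⨆ f : {f : C(ℝ, ℝ) // ∀ t ∉ U, f t = 0},
    (cfc (f.1 : ℝ → ℝ) x : H →L[ℂ] H).range).topologicalClosure

/-- For a self-adjoint operator `x` with spectral measure `E` and a Borel set `B` of real numbers:
the range of `E(B)`. By outer regularity of the spectral measure, `E(B)` is the infimum of the
projections `E(U)` over the open sets `U` that contain `B`. -/
def spectralSubspace (x : H →L[ℂ] H) (B : Set ℝ) : Submodule ℂ H :=
  ⨅ U : {U : Set ℝ // IsOpen U ∧ B ⊆ U}, openSpectralSubspace x U.1

theorem isClosed_spectralSubspace (x : H →L[ℂ] H) (B : Set ℝ) :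
    IsClosed (spectralSubspace x B : Set H) := by
  rw [spectralSubspace, Submodule.coe_iInf]
  exact isClosed_iInter fun U => Submodule.isClosed_topologicalClosure _

instance (x : H →L[ℂ] H) (B : Set ℝ) : CompleteSpace (spectralSubspace x B) :=
  (isClosed_spectralSubspace x B).completeSpace_coe

/-- The spectral projection `E(B)` of a self-adjoint operator `x` for a Borel set `B` of real
numbers: the orthogonal projection onto the spectral subspace. -/
def spectralProjOp (x : H →L[ℂ] H) (B : Set ℝ) : H →L[ℂ] H :=
  (spectralSubspace x B).starProjection

/-- The spectral projections of an element of a von Neumann algebra belong to the algebra. -/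
theorem spectralProjOp_mem (M : VonNeumannAlgebra H) (x : RV M) (B : Set ℝ) :
    spectralProjOp (x : H →L[ℂ] H) B ∈ M.toStarSubalgebra := by
  have hP : IsStarProjection (spectralProjOp (x : H →L[ℂ] H) B) :=
    isStarProjection_starProjection
  refine (VonNeumannAlgebra.IsStarProjection.mem_iff hP M).2 fun y hy => ?_
  have hxy : Commute (x : H →L[ℂ] H) y :=
    (VonNeumannAlgebra.mem_commutant_iff.1 hy) _ x.2
  have hr : (spectralProjOp (x : H →L[ℂ] H) B).range = spectralSubspace (x : H →L[ℂ] H) B := by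
    exact Submodule.range_starProjection _
  rw [hr, Module.End.mem_invtSubmodule]
  intro v hv
  rw [Submodule.mem_comap]
  simp only [spectralSubspace, Submodule.mem_iInf] at hv ⊢
  intro U
  have hinv : ∀ w ∈ (⨆ f : {f : C(ℝ, ℝ) // ∀ t ∉ U.1, f t = 0},
      (cfc (f.1 : ℝ → ℝ) (x : H →L[ℂ] H) : H →L[ℂ] H).range), y w ∈
      (⨆ f : {f : C(ℝ, ℝ) // ∀ t ∉ U.1, f t = 0},
      (cfc (f.1 : ℝ → ℝ) (x : H →L[ℂ] H) : H →L[ℂ] H).range) := by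
    intro w hw
    refine Submodule.iSup_induction _ (motive := fun w => y w ∈ _) hw ?_ (by simp) ?_
    · rintro f _ ⟨z, rfl⟩
      refine Submodule.mem_iSup_of_mem f ⟨y z, ?_⟩
      by_cases hx : IsSelfAdjoint (x : H →L[ℂ] H)
      · have := (hx.commute_cfc hxy (f.1 : ℝ → ℝ)).eq
        exact DFunLike.congr_fun this z
      · simp [cfc_apply_of_not_predicate _ hx]
    · intro a b ha hb
      rw [map_add]
      exact Submodule.add_mem _ ha hb
  exact map_mem_closure y.continuous (hv U) hinv

/-- The spectral projection `e_B(x)`, as an element of `M`, of a self-adjoint `x` in `M`. -/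
def specProj {M : VonNeumannAlgebra H} (B : Set ℝ) (x : RV M) : RV M :=
  ⟨spectralProjOp (x : H →L[ℂ] H) B, spectralProjOp_mem M x B⟩

/-- The resolution of the identity `e_c(x)`: the spectral projection of `x` for `(-∞, c)`. -/
def resolution {M : VonNeumannAlgebra H} (c : ℝ) (x : RV M) : RV M :=
  specProj (Set.Iio c) x

/-- The von Neumann algebra `W^*(S)` generated by a set `S` of elements of `M`, as a set of elements
of `M`: the intersection of all von Neumann algebras on `H` that contain `S`. -/
def generatedW {M : VonNeumannAlgebra H} (S : Set (RV M)) : Set (RV M) :=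
  {a | ∀ N : VonNeumannAlgebra H, (∀ s ∈ S, (s : H →L[ℂ] H) ∈ N) → (a : H →L[ℂ] H) ∈ N}

/-- The random variables `x 1, …, x n` are weakly fully independent: for `1 < j ≤ n`, the algebras
`W^*(x 1, …, x (j - 1))` and `W^*(x j, …, x n)` are independent. -/
def WeaklyFullyIndependent {M : VonNeumannAlgebra H} (τ : NormalFaithfulTracialState M)
    (n : ℕ) (x : ℕ → RV M) : Prop :=
  ∀ j : ℕ, 1 < j → j ≤ n →
    ∀ a ∈ generatedW (x '' Set.Ico 1 j), ∀ b ∈ generatedW (x '' Set.Icc j n),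
      τ (a * b) = τ a * τ b

/-- The partial sum `s k = x 1 + ⋯ + x k`. -/
def partialSum {M : VonNeumannAlgebra H} (x : ℕ → RV M) (k : ℕ) : RV M :=
  ∑ i ∈ Finset.Icc 1 k, x i

end QuantumProbability

end

noncomputable section

namespace QuantumProbability

universe u

variable {H : Type u} [NormedAddCommGroup H] [InnerProductSpace ℂ H] [CompleteSpace H]

/-! Take for `p` the tail projection of `s k` above λ, at a `k` maximizing the weighted traces; the
weights are at most 1, so the lower bound is immediate. For the upper bound, `y = s k` and `z = s n
- s k` commute. On the range of the tail of `y` above `a` times the tail of `z` from `b` on, `y + z`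
exceeds `a + b`, so this product is a projection below the tail of `y + z`
(`mul_spectralProjOp_eq`). Independence factors its trace (`re_mul_re_le_of_commute`). With `a = λ`
and `b = -(1 - α)λ`, the second factor is at least `m`, and dividing by `m` finishes. The comparison
of projections is reduced to quadratic forms at a single vector (`eq_zero_of_mem_spectralSubspace`).
-/

theorem openSpectralSubspace_mono (x : H →L[ℂ] H) {U V : Set ℝ} (h : U ⊆ V) :
    openSpectralSubspace x U ≤ openSpectralSubspace x V :=
  Submodule.topologicalClosure_mono <| iSup_le fun f =>
    le_iSup (fun g : {g : C(ℝ, ℝ) // ∀ t ∉ V, g t = 0} =>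
      (cfc (g.1 : ℝ → ℝ) x : H →L[ℂ] H).range) ⟨f.1, fun t ht => f.2 t fun hU => ht (h hU)⟩

theorem spectralSubspace_mono (x : H →L[ℂ] H) {B C : Set ℝ} (h : B ⊆ C) :
    spectralSubspace x B ≤ spectralSubspace x C :=
  le_iInf fun U => iInf_le
    (fun U : {U : Set ℝ // IsOpen U ∧ B ⊆ U} => openSpectralSubspace x U.1)
    ⟨U.1, U.2.1, h.trans U.2.2⟩

theorem spectralSubspace_eq_of_isOpen (x : H →L[ℂ] H) {U : Set ℝ} (hU : IsOpen U) :
    spectralSubspace x U = openSpectralSubspace x U :=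
  le_antisymm
    (iInf_le (fun V : {V : Set ℝ // IsOpen V ∧ U ⊆ V} => openSpectralSubspace x V.1)
      ⟨U, hU, subset_rfl⟩)
    (le_iInf fun V => openSpectralSubspace_mono x V.2.2)

theorem cfc_apply_mem_openSpectralSubspace (x : H →L[ℂ] H) {U : Set ℝ} (f : C(ℝ, ℝ))
    (hf : ∀ t ∉ U, f t = 0) (w : H) : cfc (f : ℝ → ℝ) x w ∈ openSpectralSubspace x U :=
  Submodule.le_topologicalClosure _ <|
    Submodule.mem_iSup_of_mem (⟨f, hf⟩ : {f : C(ℝ, ℝ) // ∀ t ∉ U, f t = 0}) ⟨w, rfl⟩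

/-- A function of `x` that vanishes on `U` annihilates the spectral subspace of `U`. -/
theorem cfc_apply_eq_zero_of_mem_openSpectralSubspace (x : H →L[ℂ] H) {U : Set ℝ}
    (f : C(ℝ, ℝ)) (hf : ∀ t ∈ U, f t = 0) {w : H} (hw : w ∈ openSpectralSubspace x U) :
    cfc (f : ℝ → ℝ) x w = 0 := by
  have hle : (⨆ g : {g : C(ℝ, ℝ) // ∀ t ∉ U, g t = 0},
      (cfc (g.1 : ℝ → ℝ) x : H →L[ℂ] H).range) ≤ (cfc (f : ℝ → ℝ) x : H →L[ℂ] H).ker := by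
    refine iSup_le fun g => ?_
    rintro _ ⟨z, rfl⟩
    have hfg : cfc (f : ℝ → ℝ) x * cfc (g.1 : ℝ → ℝ) x = 0 := by
      rw [← cfc_mul (f : ℝ → ℝ) (g.1 : ℝ → ℝ) x f.continuous.continuousOn
        g.1.continuous.continuousOn]
      have : (fun t => f t * g.1 t) = fun _ => (0 : ℝ) := by
        funext t
        by_cases ht : t ∈ U
        · rw [hf t ht, zero_mul]
        · rw [g.2 t ht, mul_zero]
      rw [this, cfc_const_zero]
    exact DFunLike.congr_fun hfg z
  exact Submodule.topologicalClosure_minimal _ hle (ContinuousLinearMap.isClosed_ker _) hw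

/-- A function of `x` that vanishes off `U` annihilates the orthogonal complement of the spectral
subspace of `U`. -/
theorem cfc_apply_eq_zero_of_mem_orthogonal (x : H →L[ℂ] H) {U : Set ℝ}
    (f : C(ℝ, ℝ)) (hf : ∀ t ∉ U, f t = 0) {w : H} (hw : w ∈ (openSpectralSubspace x U)ᗮ) :
    cfc (f : ℝ → ℝ) x w = 0 := by
  have hsa : IsSelfAdjoint (cfc (f : ℝ → ℝ) x) := cfc_predicate _ _
  have h := hw _ (cfc_apply_mem_openSpectralSubspace x f hf (cfc (f : ℝ → ℝ) x w))
  rw [← ContinuousLinearMap.adjoint_inner_right, hsa.adjoint_eq] at h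
  exact inner_self_eq_zero.1 h

/-! ### Positive and negative parts of `x - c`, and their quadratic forms. -/

/-- The function `t ↦ (t - c)⁺`. -/
def excess (c : ℝ) : C(ℝ, ℝ) := ⟨fun t => max (t - c) 0, by fun_prop⟩

/-- The function `t ↦ (c - t)⁺`. -/
def deficit (c : ℝ) : C(ℝ, ℝ) := ⟨fun t => max (c - t) 0, by fun_prop⟩

theorem excess_apply (c t : ℝ) : excess c t = max (t - c) 0 := rfl

theorem deficit_apply (c t : ℝ) : deficit c t = max (c - t) 0 := rfl

theorem cfc_excess_sub_cfc_deficit {x : H →L[ℂ] H} (hx : IsSelfAdjoint x) (c : ℝ) :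
    cfc (excess c) x - cfc (deficit c) x = x - algebraMap ℝ (H →L[ℂ] H) c := by
  rw [← cfc_sub _ _ x (excess c).continuous.continuousOn (deficit c).continuous.continuousOn]
  have : (fun t => excess c t - deficit c t) = fun t => id t - c := by
    funext t
    rw [excess_apply, deficit_apply, id]
    rcases le_total t c with h | h
    · rw [max_eq_right (by linarith), max_eq_left (by linarith)]; ring
    · rw [max_eq_left (by linarith), max_eq_right (by linarith)]; ring
  rw [this, cfc_sub _ _ x continuous_id.continuousOn continuousOn_const, cfc_id ℝ x, cfc_const c x]

/-- `S` is the self-adjoint operator `√f(x)`. Through it, vanishing of the quadratic form of `f(x)`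
at `w` forces `f(x) w = 0`. -/
theorem exists_re_inner_cfc_eq_norm_sq (x : H →L[ℂ] H) (f : C(ℝ, ℝ)) (hf : ∀ t, 0 ≤ f t) :
    ∃ S : H →L[ℂ] H, cfc (f : ℝ → ℝ) x = S * S ∧
      ∀ w, (inner ℂ (cfc (f : ℝ → ℝ) x w) w).re = ‖S w‖ ^ 2 := by
  have hsq : cfc (f : ℝ → ℝ) x = cfc (fun t => √(f t)) x * cfc (fun t => √(f t)) x := by
    rw [← cfc_mul _ _ x (by fun_prop) (by fun_prop)]
    simp only [Real.mul_self_sqrt (hf _)]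
  refine ⟨cfc (fun t => √(f t)) x, hsq, fun w => ?_⟩
  have hsa : IsSelfAdjoint (cfc (fun t => √(f t)) x) := cfc_predicate _ _
  rw [hsq, mul_apply_eq_comp, ← ContinuousLinearMap.adjoint_inner_right, hsa.adjoint_eq,
    inner_self_eq_norm_sq_to_K]
  norm_cast

theorem re_inner_cfc_nonneg (x : H →L[ℂ] H) (f : C(ℝ, ℝ)) (hf : ∀ t, 0 ≤ f t) (w : H) :
    0 ≤ (inner ℂ (cfc (f : ℝ → ℝ) x w) w).re := by
  obtain ⟨S, -, hS⟩ := exists_re_inner_cfc_eq_norm_sq x f hf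
  rw [hS]
  positivity

theorem cfc_apply_eq_zero_of_re_inner_nonpos (x : H →L[ℂ] H) (f : C(ℝ, ℝ)) (hf : ∀ t, 0 ≤ f t)
    {w : H} (hw : (inner ℂ (cfc (f : ℝ → ℝ) x w) w).re ≤ 0) : cfc (f : ℝ → ℝ) x w = 0 := by
  obtain ⟨S, hSS, hS⟩ := exists_re_inner_cfc_eq_norm_sq x f hf
  rw [hS] at hw
  have : S w = 0 := norm_eq_zero.1 (pow_eq_zero_iff two_ne_zero |>.1 (le_antisymm hw (by positivity)))
  rw [hSS, mul_apply_eq_comp, this, map_zero]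

theorem re_inner_excess_sub_deficit {x : H →L[ℂ] H} (hx : IsSelfAdjoint x) (c : ℝ) (w : H) :
    (inner ℂ (cfc (excess c) x w) w).re - (inner ℂ (cfc (deficit c) x w) w).re =
      (inner ℂ (x w) w).re - c * ‖w‖ ^ 2 := by
  have h := congrArg (fun T : H →L[ℂ] H => (inner ℂ (T w) w).re) (cfc_excess_sub_cfc_deficit hx c)
  simp only [sub_apply, inner_sub_left, Complex.sub_re] at h
  rw [h, Algebra.algebraMap_eq_smul_one, smul_apply,
    one_apply_eq_self, inner_smul_left_eq_smul, inner_self_eq_norm_sq_to_K,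
    Complex.smul_re, smul_eq_mul]
  norm_cast

/-- If `(x - c)⁺` annihilates `w` then so does every `f(x)` with `f` supported in `(c, ∞)`. -/
theorem cfc_apply_eq_zero_of_excess {x : H →L[ℂ] H} {c : ℝ} {w : H}
    (hw : cfc (excess c) x w = 0) (f : C(ℝ, ℝ)) (hf : ∀ t ∉ Set.Ioi c, f t = 0) :
    cfc (f : ℝ → ℝ) x w = 0 := by
  refine norm_le_zero_iff.1 (le_of_forall_pos_le_add fun ε hε => ?_)
  obtain ⟨δ, hδ, hfδ⟩ := Metric.continuousAt_iff.1 (f.continuous.continuousAt (x := c))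
    (ε / (‖w‖ + 1)) (by positivity)
  rw [hf c (lt_irrefl c)] at hfδ
  -- Truncating the denominator at `δ` makes `f` nearly a continuous multiple of `(t - c)⁺`: the two
  -- differ only on `(c, c + δ)`, where `|f|` is small because `f c = 0`.
  have hne : ∀ t, max (t - c) δ ≠ 0 := fun t => (lt_max_of_lt_right hδ).ne'
  have hk : Continuous fun t => f t / max (t - c) δ :=
    f.continuous.div (by fun_prop) hne
  have hz : cfc (fun t => f t / max (t - c) δ * excess c t) x w = 0 := by
    rw [cfc_mul _ _ x hk.continuousOn (excess c).continuous.continuousOn,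
      mul_apply_eq_comp, hw, map_zero]
  have hd : cfc (f : ℝ → ℝ) x w = cfc (fun t => f t - f t / max (t - c) δ * excess c t) x w := by
    rw [cfc_sub (f : ℝ → ℝ) (fun t => f t / max (t - c) δ * excess c t) x
      f.continuous.continuousOn (hk.mul (excess c).continuous).continuousOn, sub_apply, hz, sub_zero]
  have hn : ‖cfc (fun t => f t - f t / max (t - c) δ * excess c t) x‖ ≤ ε / (‖w‖ + 1) := by
    refine norm_cfc_le (by positivity) fun t _ => ?_
    rw [excess_apply]
    rcases le_or_gt t c with h | h
    · rw [hf t (not_lt.2 h)]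
      simp only [zero_div, zero_mul, sub_zero, norm_zero]
      positivity
    rw [max_eq_left (by linarith : 0 ≤ t - c)]
    rcases le_or_gt δ (t - c) with h' | h'
    · rw [max_eq_left h', div_mul_cancel₀ _ (by linarith), sub_self, norm_zero]
      positivity
    · have h1 : ‖f t‖ ≤ ε / (‖w‖ + 1) := by
        have := hfδ (x := t) (by rw [Real.dist_eq, abs_of_pos (by linarith)]; exact h')
        rw [dist_zero_right] at this
        exact this.le
      have h2 : f t - f t / max (t - c) δ * (t - c) = f t * (1 - (t - c) / δ) := by
        rw [max_eq_right h'.le]; ring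
      have h3 : (t - c) / δ ≤ 1 := (div_le_one hδ).2 h'.le
      have h4 : 0 ≤ (t - c) / δ := div_nonneg (by linarith) hδ.le
      rw [h2, norm_mul, Real.norm_of_nonneg (by linarith : 0 ≤ 1 - (t - c) / δ)]
      nlinarith [norm_nonneg (f t)]
  rw [hd, zero_add]
  calc _ ≤ ε / (‖w‖ + 1) * ‖w‖ := ContinuousLinearMap.le_of_opNorm_le _ hn w
    _ ≤ ε / (‖w‖ + 1) * (‖w‖ + 1) := by gcongr; linarith
    _ = ε := div_mul_cancel₀ _ (by positivity)

/-- The operator `(x - c)⁺` is injective on the spectral subspace of `(c, ∞)`. -/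
theorem eq_zero_of_mem_openSpectralSubspace_Ioi {x : H →L[ℂ] H} {c : ℝ} {w : H}
    (hw : w ∈ openSpectralSubspace x (Set.Ioi c)) (h : cfc (excess c) x w = 0) :
    w = 0 := by
  -- Each such self-adjoint `f(x)` kills `w`, so its range is orthogonal to `w`; hence `w` is
  -- orthogonal to itself.
  have hle : (⨆ f : {f : C(ℝ, ℝ) // ∀ t ∉ Set.Ioi c, f t = 0},
      (cfc (f.1 : ℝ → ℝ) x : H →L[ℂ] H).range) ≤ (ℂ ∙ w)ᗮ := by
    refine iSup_le fun f => ?_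
    rintro _ ⟨z, rfl⟩
    have hsa : IsSelfAdjoint (cfc (f.1 : ℝ → ℝ) x) := cfc_predicate _ _
    rw [Submodule.mem_orthogonal_singleton_iff_inner_right]
    change inner ℂ w (cfc (f.1 : ℝ → ℝ) x z) = 0
    rw [← ContinuousLinearMap.adjoint_inner_left, hsa.adjoint_eq,
      cfc_apply_eq_zero_of_excess h f.1 f.2, inner_zero_left]
  have := Submodule.topologicalClosure_minimal _ hle (Submodule.isClosed_orthogonal _) hw
  exact inner_self_eq_zero.1 (Submodule.mem_orthogonal_singleton_iff_inner_right.1 this)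

/-- On the spectral subspace of `x` for `(a, ∞)`, off that of `y` for `(-∞, b)` and off that of
`x + y` for `(a + b, ∞)`, there is only the zero vector. -/
theorem eq_zero_of_mem_spectralSubspace {x y : H →L[ℂ] H} (hx : IsSelfAdjoint x)
    (hy : IsSelfAdjoint y) {a b : ℝ} {w : H} (h1 : w ∈ spectralSubspace x (Set.Ioi a))
    (h2 : w ∈ (spectralSubspace y (Set.Iio b))ᗮ)
    (h3 : w ∈ (spectralSubspace (x + y) (Set.Ioi (a + b)))ᗮ) : w = 0 := by
  rw [spectralSubspace_eq_of_isOpen _ isOpen_Ioi] at h1 h3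
  rw [spectralSubspace_eq_of_isOpen _ isOpen_Iio] at h2
  have e1 := cfc_apply_eq_zero_of_mem_openSpectralSubspace x (deficit a)
    (fun t (ht : a < t) => max_eq_right (by linarith)) h1
  have e2 := cfc_apply_eq_zero_of_mem_orthogonal y (deficit b)
    (fun t ht => max_eq_right (by linarith [Set.notMem_Iio.1 ht])) h2
  have e3 := cfc_apply_eq_zero_of_mem_orthogonal (x + y) (excess (a + b))
    (fun t ht => max_eq_right (by linarith [Set.notMem_Ioi.1 ht])) h3
  have i1 := re_inner_excess_sub_deficit hx a w
  have i2 := re_inner_excess_sub_deficit hy b w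
  have i3 := re_inner_excess_sub_deficit (hx.add hy) (a + b) w
  rw [e1, inner_zero_left, Complex.zero_re, sub_zero] at i1
  rw [e2, inner_zero_left, Complex.zero_re, sub_zero] at i2
  rw [e3, inner_zero_left, Complex.zero_re, zero_sub, add_apply,
    inner_add_left, Complex.add_re] at i3
  -- Adding up, the forms of `(x - a)⁺`, `(y - b)⁺` and `(x + y - a - b)⁻` at `w` sum to zero. All
  -- are nonnegative, so the first one vanishes; no commutation is needed here.
  have p2 := re_inner_cfc_nonneg y (excess b) (fun t => le_max_right _ _) w
  have p3 := re_inner_cfc_nonneg (x + y) (deficit (a + b)) (fun t => le_max_right _ _) w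
  refine eq_zero_of_mem_openSpectralSubspace_Ioi h1
    (cfc_apply_eq_zero_of_re_inner_nonpos x _ (fun t => le_max_right _ _) ?_)
  linarith

/-! ### Spectral projections of commuting operators. -/

theorem isStarProjection_spectralProjOp (x : H →L[ℂ] H) (B : Set ℝ) :
    IsStarProjection (spectralProjOp x B) :=
  isStarProjection_starProjection

theorem commute_spectralProjOp {x y : H →L[ℂ] H} (hy : IsSelfAdjoint y) (h : Commute x y)
    (B : Set ℝ) : Commute (spectralProjOp x B) y := by
  -- The commutant of the self-adjoint `y` is a von Neumann algebra containing `x`, hence also the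
  -- spectral projections of `x`.
  let N : VonNeumannAlgebra H :=
    { toStarSubalgebra := StarSubalgebra.centralizer ℂ {y}
      centralizer_centralizer' := by simp }
  have hx : x ∈ StarSubalgebra.centralizer ℂ {y} := by
    simpa [StarSubalgebra.mem_centralizer_iff, hy.star_eq] using h.eq.symm
  have := spectralProjOp_mem N ⟨x, hx⟩ B
  exact (((StarSubalgebra.mem_centralizer_iff ℂ).1 this y rfl).1).symm

theorem mul_spectralProjOp_eq {x y : H →L[ℂ] H} (hx : IsSelfAdjoint x)
    (hy : IsSelfAdjoint y) (hxy : Commute x y) (a b : ℝ) :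
    spectralProjOp (x + y) (Set.Ioi (a + b)) *
        (spectralProjOp x (Set.Ioi a) * (1 - spectralProjOp y (Set.Iio b))) =
      spectralProjOp x (Set.Ioi a) * (1 - spectralProjOp y (Set.Iio b)) := by
  set Q := spectralProjOp x (Set.Ioi a)
  set R := spectralProjOp y (Set.Iio b)
  set E := spectralProjOp (x + y) (Set.Ioi (a + b))
  have hQs : IsStarProjection Q := isStarProjection_spectralProjOp _ _
  have hEx : Commute E x := commute_spectralProjOp hx ((Commute.refl x).add_left hxy.symm) _
  have hEy : Commute E y := commute_spectralProjOp hy (hxy.add_left (Commute.refl y)) _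
  have hQE : Commute Q E :=
    commute_spectralProjOp (isStarProjection_spectralProjOp _ _).isSelfAdjoint hEx.symm _
  have hRE : Commute R E :=
    commute_spectralProjOp (isStarProjection_spectralProjOp _ _).isSelfAdjoint hEy.symm _
  have hQy : Commute Q y := commute_spectralProjOp hy hxy _
  have hRQ : Commute R Q := commute_spectralProjOp hQs.isSelfAdjoint hQy.symm _
  ext v
  rw [← sub_eq_zero, ← neg_eq_zero, neg_sub, ← sub_apply]
  -- The defect is the product of the commuting projections `Q`, `1 - R`, `1 - E`. Putting each in
  -- front in turn places its values in all three ranges, whose intersection is zero.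
  have c1 : Q * (1 - R) - E * (Q * (1 - R)) = Q * ((1 - R) * (1 - E)) := by
    rw [← mul_assoc E, ← hQE.eq, mul_assoc Q E, mul_sub E, mul_one, ← hRE.eq]
    noncomm_ring
  have c2 : Q * (1 - R) - E * (Q * (1 - R)) = (1 - E) * (Q * (1 - R)) := by
    noncomm_ring
  have c3 : Q * (1 - R) - E * (Q * (1 - R)) = (1 - R) * (Q * (1 - E)) := by
    rw [c1, ← mul_assoc, ← mul_assoc, mul_sub Q, mul_one, ← hRQ.eq]
    noncomm_ring
  refine eq_zero_of_mem_spectralSubspace hx hy (a := a) (b := b) ?_ ?_ ?_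
  · rw [c1]
    exact Submodule.starProjection_apply_mem _ _
  · rw [c3]
    exact Submodule.sub_starProjection_mem_orthogonal _
  · rw [c2]
    exact Submodule.sub_starProjection_mem_orthogonal _

/-! ### Traces of projections, generated algebras and independence. -/

theorem isStarProjection_specProj {M : VonNeumannAlgebra H} (x : RV M) (B : Set ℝ) :
    IsStarProjection (specProj B x) where
  isIdempotentElem := Subtype.ext (isStarProjection_spectralProjOp _ B).isIdempotentElem
  isSelfAdjoint := Subtype.ext (isStarProjection_spectralProjOp _ B).isSelfAdjoint

theorem specProj_mem_generatedW {M : VonNeumannAlgebra H} {S : Set (RV M)} {x : RV M}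
    (hx : x ∈ generatedW S) (B : Set ℝ) : specProj B x ∈ generatedW S :=
  fun N hN => spectralProjOp_mem N ⟨x, hx N hN⟩ B

theorem one_sub_mem_generatedW {M : VonNeumannAlgebra H} {S : Set (RV M)} {x : RV M}
    (hx : x ∈ generatedW S) : 1 - x ∈ generatedW S :=
  fun N hN => sub_mem (one_mem N) (hx N hN)

theorem sum_mem_generatedW {M : VonNeumannAlgebra H} {ι : Type*} {S : Set (RV M)} {x : ι → RV M}
    {I : Finset ι} (h : ∀ i ∈ I, x i ∈ S) : ∑ i ∈ I, x i ∈ generatedW S := by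
  intro N hN
  rw [AddSubmonoidClass.coe_finsetSum]
  exact sum_mem fun i hi => hN _ (h i hi)

namespace NormalFaithfulTracialState

variable {M : VonNeumannAlgebra H} (τ : NormalFaithfulTracialState M)

theorem nonneg_of_isStarProjection {e : RV M} (he : IsStarProjection e) :
    0 ≤ (τ e).re ∧ (τ e).im = 0 := by
  refine τ.nonneg e (IsStarProjection.nonneg ⟨?_, ?_⟩)
  · exact congrArg Subtype.val he.isIdempotentElem
  · exact congrArg Subtype.val he.isSelfAdjoint

theorem re_le_of_mul_eq {e f : RV M} (he : IsStarProjection e) (hf : IsStarProjection f)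
    (h : f * e = e) : (τ e).re ≤ (τ f).re := by
  have hef : e * f = e := by
    have := congrArg star h
    rwa [star_mul, he.isSelfAdjoint.star_eq, hf.isSelfAdjoint.star_eq] at this
  have := (τ.nonneg_of_isStarProjection (he.sub_of_mul_eq_left hf hef)).1
  rw [map_sub, Complex.sub_re] at this
  linarith

theorem re_le_one {e : RV M} (he : IsStarProjection e) : (τ e).re ≤ 1 := by
  simpa [τ.map_one] using τ.re_le_of_mul_eq he (.one _) (one_mul e)

end NormalFaithfulTracialState

theorem re_specProj_mono {M : VonNeumannAlgebra H} (τ : NormalFaithfulTracialState M) (x : RV M)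
    {B C : Set ℝ} (h : B ⊆ C) : (τ (specProj B x)).re ≤ (τ (specProj C x)).re := by
  refine τ.re_le_of_mul_eq (isStarProjection_specProj _ _) (isStarProjection_specProj _ _) ?_
  exact Subtype.ext (ContinuousLinearMap.ext fun v =>
    Submodule.starProjection_eq_self_iff.2
      (spectralSubspace_mono _ h (Submodule.starProjection_apply_mem _ v)))

/-- A tail of `y + z` bounds the product of a tail of `y` and a tail of `z`, for commuting `y` and
`z` whose tails are independent. -/
theorem re_mul_re_le_of_commute {M : VonNeumannAlgebra H} (τ : NormalFaithfulTracialState M)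
    {y z : RV M} (hy : IsSelfAdjoint y) (hz : IsSelfAdjoint z) (hyz : Commute y z) (a b : ℝ)
    (hind : τ (specProj (Set.Ioi a) y * (1 - resolution b z)) =
      τ (specProj (Set.Ioi a) y) * τ (1 - resolution b z)) :
    (τ (specProj (Set.Ioi a) y)).re * (τ (1 - resolution b z)).re ≤
      (τ (specProj (Set.Ioi (a + b)) (y + z))).re := by
  have hy' : IsSelfAdjoint (y : H →L[ℂ] H) := congrArg Subtype.val hy
  have hz' : IsSelfAdjoint (z : H →L[ℂ] H) := congrArg Subtype.val hz
  have hyz' : Commute (y : H →L[ℂ] H) z := congrArg Subtype.val hyz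
  have hQ := isStarProjection_specProj y (Set.Ioi a)
  have hR : IsStarProjection (1 - resolution b z) := (isStarProjection_specProj z _).one_sub
  have hzQ : Commute (z : H →L[ℂ] H) (spectralProjOp (y : H →L[ℂ] H) (Set.Ioi a)) :=
    (commute_spectralProjOp hz' hyz' _).symm
  have hRQ : Commute (resolution b z) (specProj (Set.Ioi a) y) := Subtype.ext
    (commute_spectralProjOp (isStarProjection_spectralProjOp _ _).isSelfAdjoint hzQ _)
  have hQR : IsStarProjection (specProj (Set.Ioi a) y * (1 - resolution b z)) :=
    hQ.mul hR ((Commute.one_right _).sub_right hRQ.symm)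
  have hle := τ.re_le_of_mul_eq hQR (isStarProjection_specProj (y + z) (Set.Ioi (a + b)))
    (Subtype.ext (mul_spectralProjOp_eq hy' hz' hyz' a b))
  -- The trace of a projection is real, so the real part of the product is the product of the real
  -- parts.
  rwa [hind, Complex.mul_re, (τ.nonneg_of_isStarProjection hQ).2, zero_mul, sub_zero] at hle

end QuantumProbability

end

open QuantumProbability in
/-- A tail of a partial sum is controlled by a tail of the total sum. -/
theorem QuantumProbability.WeaklyFullyIndependent.re_mul_re_le {H : Type*} [NormedAddCommGroup H]
    [InnerProductSpace ℂ H] [CompleteSpace H]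
    {M : VonNeumannAlgebra H} {τ : NormalFaithfulTracialState M} {n : ℕ} {x : ℕ → RV M}
    (hind : WeaklyFullyIndependent τ n x) (hsa : ∀ k ∈ Finset.Icc 1 n, IsSelfAdjoint (x k))
    {k : ℕ} (hk : k ∈ Finset.Icc 1 n)
    (hcomm : Commute (partialSum x k) (partialSum x n)) (a : ℝ) {b : ℝ} (hb : b ≤ 0) :
    (τ (specProj (Set.Ioi a) (partialSum x k))).re *
        (τ (1 - resolution b (partialSum x n - partialSum x k))).re ≤
      (τ (specProj (Set.Ioi (a + b)) (partialSum x n))).re := by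
  obtain ⟨hk1, hkn⟩ := Finset.mem_Icc.1 hk
  rcases hkn.eq_or_lt with rfl | hlt
  -- For `k = n` there is no independence to use: the second factor is at most 1, and `b ≤ 0` only
  -- enlarges the tail.
  · have hmono := re_specProj_mono τ (partialSum x k)
      (Set.Ioi_subset_Ioi (by linarith : a + b ≤ a))
    refine (mul_le_of_le_one_right ?_ ?_).trans hmono
    · exact (τ.nonneg_of_isStarProjection (isStarProjection_specProj _ _)).1
    · exact τ.re_le_one (isStarProjection_specProj _ _).one_sub
  · have hsum : ∀ j ≤ n, IsSelfAdjoint (partialSum x j) := fun j hj =>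
      isSelfAdjoint_sum _ fun i hi => hsa i (Finset.Icc_subset_Icc_right hj hi)
    have hdiff : partialSum x n - partialSum x k = ∑ i ∈ Finset.Icc (k + 1) n, x i := by
      have := Finset.sum_Ioc_consecutive x (Nat.zero_le k) hkn
      simp only [← Finset.Icc_add_one_left_eq_Ioc] at this
      exact sub_eq_of_eq_add' this.symm
    -- The cut is at `j = k + 1`: the two tails lie in the algebras of `x 1, …, x k` and of `x (k +
    -- 1), …, x n`.
    have h := re_mul_re_le_of_commute τ (hsum k hkn) ((hsum n le_rfl).sub (hsum k hkn))
      (hcomm.sub_right (Commute.refl _)) a b (hind (k + 1) (by omega) hlt _ ?_ _ ?_)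
    · rwa [add_sub_cancel] at h
    · refine specProj_mem_generatedW (sum_mem_generatedW fun i hi => ?_) _
      exact ⟨i, ⟨(Finset.mem_Icc.1 hi).1, Nat.lt_succ_of_le (Finset.mem_Icc.1 hi).2⟩, rfl⟩
    · refine one_sub_mem_generatedW (specProj_mem_generatedW ?_ _)
      rw [hdiff]
      exact sum_mem_generatedW fun i hi => ⟨i, Finset.mem_Icc.1 hi, rfl⟩

theorem theorem2p8 {H : Type*} [NormedAddCommGroup H] [InnerProductSpace ℂ H] [CompleteSpace H]
    (M : VonNeumannAlgebra H) (τ : QuantumProbability.NormalFaithfulTracialState M)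
    (n : ℕ) (hn : 1 ≤ n) (x : ℕ → QuantumProbability.RV M)
    (hsa : ∀ k ∈ Finset.Icc 1 n, IsSelfAdjoint (x k))
    (hind : QuantumProbability.WeaklyFullyIndependent τ n x)
    (s : ℕ → QuantumProbability.RV M) (hs : s = QuantumProbability.partialSum x)
    (hcomm : ∀ k ∈ Finset.Icc 1 n, s k * s n = s n * s k)
    (lam : ℝ) (hlam : 0 < lam) (α : ℝ) (hα0 : 0 < α) (hα1 : α < 1)
    (m : ℝ)
    (hm : m = (Finset.Icc 1 n).inf' (Finset.nonempty_Icc.mpr hn) (fun k =>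
      (τ (1 - QuantumProbability.resolution (-((1 - α) * lam)) (s n - s k))).re)) :
    ∃ p : QuantumProbability.RV M, IsStarProjection p ∧
      (Finset.Icc 1 n).sup' (Finset.nonempty_Icc.mpr hn) (fun k =>
        1 / (2 : ℝ) ^ (k - 1) * (τ (QuantumProbability.specProj (Set.Ioi lam) (s k))).re)
        ≤ (τ p).re ∧
      -- `M_λ = 1 / m`, and the upper bound is void when `m = 0`, that is, when `M_λ = ∞`
      (m ≠ 0 →
        (τ p).re ≤ 1 / m * (τ (QuantumProbability.specProj (Set.Ioi (α * lam)) (s n))).re) := by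

  subst hs
  have hq : ∀ k, IsStarProjection (QuantumProbability.specProj (Set.Ioi lam)
      (QuantumProbability.partialSum x k)) :=
    fun k => QuantumProbability.isStarProjection_specProj _ _
  obtain ⟨k, hk, hmax⟩ := Finset.exists_mem_eq_sup' (Finset.nonempty_Icc.mpr hn) fun k =>
    1 / (2 : ℝ) ^ (k - 1) * (τ (QuantumProbability.specProj (Set.Ioi lam)
      (QuantumProbability.partialSum x k))).re
  have hτq := (τ.nonneg_of_isStarProjection (hq k)).1
  refine ⟨_, hq k, hmax.trans_le (mul_le_of_le_one_left hτq ?_), fun hm0 => ?_⟩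
  · rw [one_div]
    exact inv_le_one_of_one_le₀ (one_le_pow₀ one_le_two)
  · have hmpos : 0 < m := lt_of_le_of_ne (hm ▸ Finset.le_inf' _ _ fun j _ =>
      (τ.nonneg_of_isStarProjection
        (QuantumProbability.isStarProjection_specProj _ _).one_sub).1) hm0.symm
    -- The minimum defining `m` bounds the second factor at the maximizing `k` from below.
    have hmk : m ≤ _ := hm.trans_le (Finset.inf'_le _ hk)
    have hle := hind.re_mul_re_le hsa hk (hcomm k hk) lam
      (b := -((1 - α) * lam)) (by nlinarith)
    rw [show lam + -((1 - α) * lam) = α * lam by ring] at hle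
    rw [one_div, inv_mul_eq_div, le_div_iff₀ hmpos]
    exact (mul_le_mul_of_nonneg_left hmk hτq).trans hle
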